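/- Let $n\ge 1$ and $k\ge 1$, and let $T\subset\mathbb R^n$ be a nondegenerate $n$-simplex with barycentric coordinates $\lambda_0,\dots,\lambda_n$. For $0\le\ell\le n$ let $\Delta_\ell(T)$ be the set of $\ell$-dimensional sub-simplices of $T$, so that $\Delta_n(T)=\{T\}$. For $f\in\Delta_\ell(T)$ let $\mathscr T^f\subseteq\mathbb R^n$ be its tangent plane, let $\mathbb P_k(f)$ be the space of functions on $f$ spanned by the monomials of degree $k$ in the barycentric coordinates of the vertices of $f$ (that is, of polynomials of degree at most $k$ on $f$), and put $\mathbb P_k^n(T)=\mathbb P_k(T)\otimes\mathbb R^n$. For $f\in\Delta_\ell(T)$ with $2\le\ell\le n$ let $$\mathbb B_k(\mathrm{curl}_f,f)=\{\boldsymbol v\in\mathbb P_k(f)\otimes\mathscr T^f:\ (\boldsymbol v\,(\boldsymbol n_f^e)^{\intercal}-\boldsymbol n_f^e\,\boldsymbol v^{\intercal})|_e=0\ \text{ for all }(\ell-1)\text{-dimensional faces } e \text{ of } f\},$$ where $\boldsymbol n_f^e\in\mathscr T^f$ is a unit vector normal to $e$; these are the fields in $\mathbb P_k(f)\otimes\mathscr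 T^f$ whose tangential components vanish on $\partial f$. For each edge $e\in\Delta_1(T)$ let $\boldsymbol t=\boldsymbol t_e$ be any vector spanning $\mathscr T^e$. Then the degrees of freedom $$\int_e \boldsymbol u\cdot\boldsymbol t\;p\,\mathrm ds,\qquad p\in\mathbb P_k(e),\ e\in\Delta_1(T),$$ $$\int_f \boldsymbol u\cdot\boldsymbol p\,\mathrm ds,\qquad \boldsymbol p\in\mathbb B_k(\mathrm{curl}_f,f),\ f\in\Delta_\ell(T),\ \ell=2,\dots,n,$$ are unisolvent for the shape function space $\mathbb P_k^n(T)$: for every choice of linear functionals $a_e$ on $\mathbb P_k(e)$ $(e\in\Delta_1(T))$ and $b_f$ on $\mathbb B_k(\mathrm{curl}_f,f)$ $(f\in\Delta_\ell(T),\ 2\le\ell\le n)$ there is exactly one $\boldsymbol u\in\mathbb P_k^n(T)$ with $\int_e \boldsymbol u\cdot\boldsymbol t\,p\,\mathrm ds=a_e(p)$ and $\int_f\boldsymbol u\cdot\boldsymbol p\,\mathrm ds=b_f(\boldsymbol p)$ for all these $e,f,p,\boldsymbol p$. (The simplex $T$ with this shape function space and these degrees of freedom is called the second-kind Nédélec,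 or edge, element of degree $k$.) -/

import Mathlib

open scoped MeasureTheory RealInnerProductSpace

noncomputable section

namespace EdgeElement

/-- A nondegenerate `n`-simplex in `ℝⁿ` is `T : Affine.Simplex ℝ (EuclideanSpace ℝ (Fin n)) n`:
its `n + 1` vertices `T.points i` are affinely independent. -/
abbrev Euc (n : ℕ) : Type := EuclideanSpace ℝ (Fin n)

/-- The set `Δ_ℓ` of sub-simplices of dimension `ℓ`, each given by its set of `ℓ + 1` vertex
indices. -/
def subsimplices (n l : ℕ) : Finset (Finset (Fin (n + 1))) :=
  Finset.powersetCard (l + 1) Finset.univ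

variable {n : ℕ}

/-- The vertices of an `n`-simplex of `ℝⁿ` as an affine basis. -/
def vertexBasis (T : Affine.Simplex ℝ (Euc n) n) : AffineBasis (Fin (n + 1)) ℝ (Euc n) :=
  ⟨T.points, T.independent, T.span_eq_top (by simp)⟩

/-- The barycentric coordinate `λ_i` of the simplex `T`. -/
def bary (T : Affine.Simplex ℝ (Euc n) n) (i : Fin (n + 1)) (x : Euc n) : ℝ :=
  (vertexBasis T).coord i x

/-- The geometric (closed) sub-simplex spanned by the vertices with index in `f`. -/
def carrier (T : Affine.Simplex ℝ (Euc n) n) (f : Finset (Fin (n + 1))) : Set (Euc n) :=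
  convexHull ℝ (T.points '' (f : Set (Fin (n + 1))))

theorem carrier_mono (T : Affine.Simplex ℝ (Euc n) n) {e f : Finset (Fin (n + 1))} (h : e ⊆ f) :
    carrier T e ⊆ carrier T f :=
  convexHull_mono (Set.image_mono (Finset.coe_subset.mpr h))

/-- The inclusion of a sub-simplex into the whole simplex; `u ∘ inc T f` is the restriction of `u`
to `f`. -/
def inc (T : Affine.Simplex ℝ (Euc n) n) (f : Finset (Fin (n + 1))) :
    carrier T f → carrier T Finset.univ :=
  Set.inclusion (carrier_mono T (Finset.subset_univ f))

/-- The tangent plane `𝒯^f` of the sub-simplex `f`, as a linear subspace of `ℝⁿ`. -/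
def tangentPlane (T : Affine.Simplex ℝ (Euc n) n) (f : Finset (Fin (n + 1))) :
    Submodule ℝ (Euc n) :=
  vectorSpan ℝ (T.points '' (f : Set (Fin (n + 1))))

/-- The surface measure `ds` on the sub-simplex `f`: the Hausdorff measure of the dimension of `f`,
normalized to agree with Lebesgue measure on Euclidean spaces. -/
def surfaceMeasure (T : Affine.Simplex ℝ (Euc n) n) (f : Finset (Fin (n + 1))) :
    MeasureTheory.Measure (carrier T f) :=
  (μHE[f.card - 1] : MeasureTheory.Measure (Euc n)).comap Subtype.val

/-- `P_k(f)`, as a space of functions on `f`: the span of the Bernstein monomials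
`∏_{i ∈ f} λ_i ^ α_i` with `∑_{i ∈ f} α_i = k`. -/
def polySpace (T : Affine.Simplex ℝ (Euc n) n) (k : ℕ) (f : Finset (Fin (n + 1))) :
    Submodule ℝ (carrier T f → ℝ) :=
  Submodule.span ℝ {g | ∃ α : Fin (n + 1) → ℕ, ∑ i ∈ f, α i = k ∧
    g = fun x : carrier T f => ∏ i ∈ f, bary T i (x : Euc n) ^ α i}

/-- `P_k(f) ⊗ ℝⁿ`: the vector fields on `f` all of whose components lie in `P_k(f)`. For `f = T`
(all vertices) this is the shape function space `P_k^n(T)`. -/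
def vecPolySpace (T : Affine.Simplex ℝ (Euc n) n) (k : ℕ) (f : Finset (Fin (n + 1))) :
    Submodule ℝ (carrier T f → Euc n) where
  carrier := {v | ∀ j : Fin n, (fun x => v x j) ∈ polySpace T k f}
  add_mem' hu hv j := (polySpace T k f).add_mem (hu j) (hv j)
  zero_mem' _ := (polySpace T k f).zero_mem
  smul_mem' c _ hv j := (polySpace T k f).smul_mem c (hv j)

/-- `v νᵀ - ν vᵀ = 2 skw(v νᵀ)`, the value of the trace of `curl` on a facet with unit normal `ν`
for a vector field with value `v`. -/
def curlTrace (ν v : Euc n) : Matrix (Fin n) (Fin n) ℝ :=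
  Matrix.vecMulVec v ν - Matrix.vecMulVec ν v

/-- `ν` is a unit normal vector, tangential to `f`, of the facet `f \ {i}` of `f`. -/
def IsUnitFacetNormal (T : Affine.Simplex ℝ (Euc n) n) (f : Finset (Fin (n + 1)))
    (i : Fin (n + 1)) (ν : Euc n) : Prop :=
  ν ∈ tangentPlane T f ∧ ‖ν‖ = 1 ∧ ∀ w ∈ tangentPlane T (f.erase i), ⟪ν, w⟫ = 0

/-- The bubble space `B_k(curl_f, f)`: the vector fields in `P_k(f) ⊗ 𝒯^f` whose trace of `curl_f`
vanishes on all facets `f \ {i}` of `f`. -/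
def curlBubble (T : Affine.Simplex ℝ (Euc n) n) (k : ℕ) (f : Finset (Fin (n + 1))) :
    Submodule ℝ (carrier T f → Euc n) where
  carrier := {v | v ∈ vecPolySpace T k f ∧ (∀ x, v x ∈ tangentPlane T f) ∧
    ∀ i ∈ f, ∀ ν, IsUnitFacetNormal T f i ν →
      ∀ x : carrier T f, (x : Euc n) ∈ carrier T (f.erase i) → curlTrace ν (v x) = 0}
  add_mem' := by
    rintro u v ⟨hu, hu', hu''⟩ ⟨hv, hv', hv''⟩
    refine ⟨add_mem hu hv, fun x => add_mem (hu' x) (hv' x), fun i hi ν hν x hx => ?_⟩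
    have h1 := hu'' i hi ν hν x hx
    have h2 := hv'' i hi ν hν x hx
    simp only [curlTrace] at h1 h2 ⊢
    simp only [Pi.add_apply, WithLp.ofLp_add, Matrix.add_vecMulVec, Matrix.vecMulVec_add]
    rw [add_sub_add_comm, h1, h2, add_zero]
  zero_mem' := by
    refine ⟨zero_mem _, fun x => zero_mem _, fun i hi ν hν x hx => ?_⟩
    simp [curlTrace]
  smul_mem' := by
    rintro c v ⟨hv, hv', hv''⟩
    refine ⟨Submodule.smul_mem _ c hv, fun x => Submodule.smul_mem _ c (hv' x),
      fun i hi ν hν x hx => ?_⟩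
    have h := hv'' i hi ν hν x hx
    simp only [curlTrace] at h ⊢
    simp only [Pi.smul_apply, WithLp.ofLp_smul, Matrix.smul_vecMulVec, Matrix.vecMulVec_smul]
    rw [← smul_sub, h, smul_zero]

end EdgeElement

end

noncomputable section

namespace EdgeElement

variable {n : ℕ}

/-! ### Barycentric coordinates on the simplex and its faces. -/

section Barycentric

variable (T : Affine.Simplex ℝ (Euc n) n)

/-! On an edge the bubble fields are exactly the fields `p t` with `p` in `P_k(e)`, so both families
of functionals are moments against bubble spaces, and the claim is that the single map `moments` is
bijective.

Injectivity is an induction over faces. If the tangential part of `u` vanishes on every proper face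
of `f`, the projection of `u|_f` to the tangent plane is a bubble on `f`; testing `u` with this
bubble gives its squared norm, so it vanishes (`inner_eq_zero_of_moments`). On `T` itself the
tangent plane is everything.

Surjectivity is a dimension count in which an upper bound suffices. Let `S` be the support of `α`.
The `λ^α`-coefficient of a bubble on `f ⊇ S` lies in the tangent plane of `f` and is normal to each
facet `f \ {i}` with `i ∉ S`. This leaves dimension at most `|S| - 1` if `f = S`, at most 1 if `f`
has one vertex more, and 0 otherwise (`finrank_bubbleCoeff_le`). Summing over `f` gives `(|S| - 1) +
(n + 1 - |S|) = n`, the number of components that each monomial contributes to the shape functions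
(`sum_finrank_curlBubble_le`). -/

theorem continuous_bary (i : Fin (n + 1)) : Continuous (bary T i) :=
  ((vertexBasis T).coord i).continuous_of_finiteDimensional

theorem points_mem_carrier {f : Finset (Fin (n + 1))} {i : Fin (n + 1)} (hi : i ∈ f) :
    T.points i ∈ carrier T f :=
  subset_convexHull ℝ _ ⟨i, hi, rfl⟩

theorem bary_sum_smul {y : Fin (n + 1) → ℝ} (hy : ∑ i, y i = 1) (i : Fin (n + 1)) :
    bary T i (∑ j, y j • T.points j) = y i := by
  have h := (vertexBasis T).coord_apply_combination_of_mem (Finset.mem_univ i) hy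
  rw [Finset.affineCombination_eq_linear_combination _ _ _ hy] at h
  exact h

theorem sum_smul_mem_carrier {f : Finset (Fin (n + 1))} {y : Fin (n + 1) → ℝ}
    (h0 : ∀ i, 0 ≤ y i) (hf : ∀ i ∉ f, y i = 0) (hy : ∑ i, y i = 1) :
    ∑ j, y j • T.points j ∈ carrier T f := by
  have hs : ∑ i ∈ f, y i = 1 := by
    rw [← hy]; exact Finset.sum_subset (Finset.subset_univ f) fun i _ hi => hf i hi
  have : ∑ j, y j • T.points j = ∑ j ∈ f, y j • T.points j :=
    (Finset.sum_subset (Finset.subset_univ f) fun i _ hi => by rw [hf i hi, zero_smul]).symm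
  rw [this]
  exact (convex_convexHull ℝ _).sum_mem (fun i _ => h0 i) hs fun i hi => points_mem_carrier T hi

theorem bary_eq_zero {f : Finset (Fin (n + 1))} {i : Fin (n + 1)} (hi : i ∉ f) {x : Euc n}
    (hx : x ∈ carrier T f) : bary T i x = 0 := by
  have hsub : carrier T f ⊆ {x | bary T i x = 0} := by
    refine convexHull_min ?_ ?_
    · rintro _ ⟨j, hj, rfl⟩
      have hij : i ≠ j := fun h => hi (h ▸ hj)
      exact (vertexBasis T).coord_apply_ne hij
    · have : {x | bary T i x = 0} = ((vertexBasis T).coord i) ⁻¹' {0} := rfl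
      rw [this]
      exact (convex_singleton 0).affine_preimage _
  exact hsub hx

end Barycentric

/-! ### Bernstein bases of scalar and vector polynomials on a face. -/

section Bernstein

variable (T : Affine.Simplex ℝ (Euc n) n)

/-- The Bernstein monomial `λ^α` on the sub-simplex `f`. -/
def bernstein (f : Finset (Fin (n + 1))) (α : Fin (n + 1) → ℕ) (x : carrier T f) : ℝ :=
  ∏ i ∈ f, bary T i (x : Euc n) ^ α i

theorem continuous_bernstein (f : Finset (Fin (n + 1))) (α : Fin (n + 1) → ℕ) :
    Continuous (bernstein T f α) :=
  continuous_finsetProd _ fun i _ => ((continuous_bary T i).comp continuous_subtype_val).pow _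

/-- Bernstein monomials of degree `k ≥ 1` are linearly independent on a sub-simplex. -/
theorem bernstein_coeff_eq_zero {k : ℕ} {f : Finset (Fin (n + 1))} (hf : f.Nonempty)
    (c : Finset.piAntidiag f k → ℝ) (h : ∀ x, ∑ α, c α * bernstein T f α x = 0) : c = 0 := by
  classical
  let P : MvPolynomial (Fin (n + 1)) ℝ :=
    ∑ α : Finset.piAntidiag f k, MvPolynomial.monomial (Finsupp.equivFunOnFinite.symm α.1) (c α)
  have hP : P = 0 := by
    refine MvPolynomial.funext_set (fun _ => Set.Ioi (0 : ℝ)) (fun _ => Set.Ioi_infinite 0) ?_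
    intro y hy
    have hy : ∀ i, 0 < y i := fun i => hy i (Set.mem_univ i)
    set s := ∑ i ∈ f, y i with hs
    have hs0 : 0 < s := Finset.sum_pos (fun i _ => hy i) hf
    -- Homogeneity: a positive point divided by its coordinate sum on `f` gives barycentric
    -- coordinates in `f`, at the cost of a factor `s ^ k`. Vanishing on the face thus becomes
    -- vanishing on the positive orthant.
    let z : Fin (n + 1) → ℝ := fun i => if i ∈ f then y i / s else 0
    have hz : ∑ i, z i = 1 := by
      simp only [z, Finset.sum_ite_mem, Finset.univ_inter, ← Finset.sum_div]
      exact div_self hs0.ne'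
    have hx := sum_smul_mem_carrier T (f := f) (y := z)
      (fun i => by simp only [z]; split_ifs; exacts [(div_pos (hy i) hs0).le, le_rfl])
      (fun i hi => by simp [z, hi]) hz
    have h1 := h ⟨_, hx⟩
    simp only [P, map_sum, MvPolynomial.eval_monomial, map_zero]
    have h2 : ∀ α : Finset.piAntidiag f k,
        (Finsupp.equivFunOnFinite.symm α.1).prod (fun i e => y i ^ e)
          = s ^ k * bernstein T f α ⟨_, hx⟩ := by
      intro α
      obtain ⟨hα, hα'⟩ := Finset.mem_piAntidiag.1 α.2
      rw [Finsupp.prod_fintype _ _ (by simp)]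
      simp only [Finsupp.equivFunOnFinite_symm_apply_apply, bernstein, bary_sum_smul T hz]
      have hsk : s ^ k = ∏ i ∈ f, s ^ α.1 i := by rw [Finset.prod_pow_eq_pow_sum, hα]
      rw [← Finset.prod_subset (Finset.subset_univ f), hsk, ← Finset.prod_mul_distrib]
      · refine Finset.prod_congr rfl fun i hi => ?_
        simp only [z, hi, if_true]
        rw [← mul_pow, mul_div_cancel₀ _ hs0.ne']
      · intro i _ hi
        have : α.1 i = 0 := by by_contra h; exact hi (hα' i h)
        simp [this]
    simp only [h2]
    calc _ = s ^ k * ∑ α, c α * bernstein T f α ⟨_, hx⟩ := by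
          rw [Finset.mul_sum]; exact Finset.sum_congr rfl fun α _ => by ring
      _ = 0 := by rw [h1, mul_zero]
  funext β
  have h3 := congrArg (MvPolynomial.coeff (Finsupp.equivFunOnFinite.symm β.1)) hP
  simp only [P, MvPolynomial.coeff_sum, MvPolynomial.coeff_monomial, EmbeddingLike.apply_eq_iff_eq,
    MvPolynomial.coeff_zero] at h3
  simpa [Subtype.val_inj] using h3

/-- The vector field `∑ λ^α c_α` on `f` with Bernstein coefficients `c`. -/
def bernsteinField (k : ℕ) (f : Finset (Fin (n + 1))) :
    (Finset.piAntidiag f k → Euc n) →ₗ[ℝ] (carrier T f → Euc n) where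
  toFun c x := ∑ α : Finset.piAntidiag f k, bernstein T f α x • c α
  map_add' c d := by funext x; simp [Finset.sum_add_distrib]
  map_smul' r c := by
    funext x
    simp only [Pi.smul_apply, RingHom.id_apply, Finset.smul_sum]
    exact Finset.sum_congr rfl fun α _ => smul_comm _ _ _

theorem bernsteinField_apply {k : ℕ} {f : Finset (Fin (n + 1))}
    (c : Finset.piAntidiag f k → Euc n) (x : carrier T f) :
    bernsteinField T k f c x = ∑ α : Finset.piAntidiag f k, bernstein T f α x • c α := rfl

theorem continuous_bernsteinField {k : ℕ} {f : Finset (Fin (n + 1))}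
    (c : Finset.piAntidiag f k → Euc n) : Continuous (bernsteinField T k f c) :=
  continuous_finsetSum _ fun α _ => (continuous_bernstein T f α).smul continuous_const

theorem bernsteinField_injective {k : ℕ} {f : Finset (Fin (n + 1))} (hf : f.Nonempty) :
    Function.Injective (bernsteinField T k f) := by
  rw [← LinearMap.ker_eq_bot, LinearMap.ker_eq_bot']
  intro c hc
  have h : ∀ j : Fin n, (fun α => c α j) = 0 := fun j =>
    bernstein_coeff_eq_zero T hf _ fun x => by
      have := congrArg (fun v : Euc n => v j) (congrFun hc x)
      simpa [bernsteinField_apply, mul_comm] using this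
  funext α
  ext j
  exact congrFun (h j) α

theorem bernstein_mem_polySpace {k : ℕ} {f : Finset (Fin (n + 1))} (α : Finset.piAntidiag f k) :
    bernstein T f α ∈ polySpace T k f :=
  Submodule.subset_span ⟨α.1, (Finset.mem_piAntidiag.1 α.2).1, rfl⟩

theorem mem_polySpace_iff {k : ℕ} {f : Finset (Fin (n + 1))} {g : carrier T f → ℝ} :
    g ∈ polySpace T k f ↔
      ∃ c : Finset.piAntidiag f k → ℝ, g = fun x => ∑ α : Finset.piAntidiag f k, bernstein T f α x * c α := by
  classical
  constructor
  · have hle : polySpace T k f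
        ≤ Submodule.span ℝ (Set.range fun α : Finset.piAntidiag f k => bernstein T f α.1) := by
      refine Submodule.span_mono ?_
      rintro _ ⟨α, hα, rfl⟩
      -- Exponents outside `f` do not affect the monomial; cutting them off leaves a finite index
      -- set.
      let β : Fin (n + 1) → ℕ := fun i => if i ∈ f then α i else 0
      have hβ : β ∈ Finset.piAntidiag f k := by
        rw [Finset.mem_piAntidiag]
        refine ⟨?_, fun i hi => ?_⟩
        · rw [← hα]; exact Finset.sum_congr rfl fun i hi => by simp [β, hi]
        · by_contra h; simp [β, h] at hi
      refine ⟨⟨β, hβ⟩, ?_⟩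
      funext x
      exact Finset.prod_congr rfl fun i hi => by simp [β, hi]
    intro hg
    obtain ⟨c, hc⟩ := (Submodule.mem_span_range_iff_exists_fun ℝ).1 (hle hg)
    refine ⟨c, ?_⟩
    rw [← hc]
    funext x
    simp [Finset.sum_apply, mul_comm]
  · rintro ⟨c, rfl⟩
    have : (fun x => ∑ α : Finset.piAntidiag f k, bernstein T f α x * c α)
        = ∑ α : Finset.piAntidiag f k, c α • bernstein T f α.1 := by
      funext x; simp [Finset.sum_apply, mul_comm]
    rw [this]
    exact Submodule.sum_mem _ fun α _ =>
      Submodule.smul_mem _ _ (bernstein_mem_polySpace T α)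

theorem range_bernsteinField (k : ℕ) (f : Finset (Fin (n + 1))) :
    LinearMap.range (bernsteinField T k f) = vecPolySpace T k f := by
  ext v
  constructor
  · rintro ⟨c, rfl⟩ j
    refine (mem_polySpace_iff T).2 ⟨fun α => c α j, ?_⟩
    funext x
    simp [bernsteinField_apply]
  · intro hv
    choose c hc using fun j => (mem_polySpace_iff T).1 (hv j)
    refine ⟨fun α => WithLp.toLp 2 fun j => c j α, ?_⟩
    funext x
    ext j
    simpa [bernsteinField_apply] using (congrFun (hc j) x).symm

theorem exists_bernsteinField_eq {k : ℕ} {f : Finset (Fin (n + 1))} {v : carrier T f → Euc n}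
    (hv : v ∈ vecPolySpace T k f) : ∃ c, bernsteinField T k f c = v := by
  rwa [← range_bernsteinField] at hv

theorem bernsteinField_mem {k : ℕ} {f : Finset (Fin (n + 1))}
    (c : Finset.piAntidiag f k → Euc n) : bernsteinField T k f c ∈ vecPolySpace T k f := by
  rw [← range_bernsteinField]; exact ⟨c, rfl⟩

instance (k : ℕ) (f : Finset (Fin (n + 1))) : FiniteDimensional ℝ (vecPolySpace T k f) := by
  rw [← range_bernsteinField]; infer_instance

theorem continuous_of_mem_vecPolySpace {k : ℕ} {f : Finset (Fin (n + 1))}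
    {v : carrier T f → Euc n} (hv : v ∈ vecPolySpace T k f) : Continuous v := by
  obtain ⟨c, rfl⟩ := exists_bernsteinField_eq T hv
  exact continuous_bernsteinField T c

theorem comp_linear_mem_vecPolySpace {k : ℕ} {f : Finset (Fin (n + 1))}
    {v : carrier T f → Euc n} (hv : v ∈ vecPolySpace T k f) (A : Euc n →ₗ[ℝ] Euc n) :
    (fun x => A (v x)) ∈ vecPolySpace T k f := by
  obtain ⟨c, rfl⟩ := exists_bernsteinField_eq T hv
  convert bernsteinField_mem T fun α => A (c α) using 1
  funext x
  simp [bernsteinField_apply]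

theorem inner_mem_polySpace {k : ℕ} {f : Finset (Fin (n + 1))}
    {v : carrier T f → Euc n} (hv : v ∈ vecPolySpace T k f) (w : Euc n) :
    (fun x => ⟪v x, w⟫) ∈ polySpace T k f := by
  obtain ⟨c, rfl⟩ := exists_bernsteinField_eq T hv
  refine (mem_polySpace_iff T).2 ⟨fun α => ⟪c α, w⟫, ?_⟩
  funext x
  simp [bernsteinField_apply, sum_inner, real_inner_smul_left]

theorem smul_const_mem_vecPolySpace {k : ℕ} {f : Finset (Fin (n + 1))}
    {g : carrier T f → ℝ} (hg : g ∈ polySpace T k f) (w : Euc n) :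
    (fun x => g x • w) ∈ vecPolySpace T k f := by
  intro j
  convert (polySpace T k f).smul_mem (w j) hg using 1
  funext x
  simp [mul_comm]

/-- A monomial with a positive exponent outside `f` vanishes on `f`; any other is already a monomial
of `f`. -/
theorem comp_inc_mem_polySpace {k : ℕ} (f : Finset (Fin (n + 1)))
    {g : carrier T Finset.univ → ℝ} (hg : g ∈ polySpace T k Finset.univ) :
    g ∘ inc T f ∈ polySpace T k f := by
  have hle : polySpace T k Finset.univ
      ≤ (polySpace T k f).comap (LinearMap.funLeft ℝ ℝ (inc T f)) := by
    refine Submodule.span_le.2 ?_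
    rintro _ ⟨α, hα, rfl⟩
    change _ ∈ polySpace T k f
    by_cases h : ∀ i ∉ f, α i = 0
    · refine Submodule.subset_span ⟨α, ?_, ?_⟩
      · rw [← hα]; exact Finset.sum_subset (Finset.subset_univ f) fun i _ hi => h i hi
      · funext x
        exact (Finset.prod_subset (Finset.subset_univ f) fun i _ hi => by simp [h i hi]).symm
    · push Not at h
      obtain ⟨i, hi, hi'⟩ := h
      convert (polySpace T k f).zero_mem using 1
      funext x
      refine Finset.prod_eq_zero (Finset.mem_univ i) ?_
      rw [show ((inc T f x : carrier T Finset.univ) : Euc n) = x from rfl,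
        bary_eq_zero T hi x.2, zero_pow hi']
  exact hle hg

theorem comp_inc_mem_vecPolySpace {k : ℕ} (f : Finset (Fin (n + 1)))
    {u : carrier T Finset.univ → Euc n} (hu : u ∈ vecPolySpace T k Finset.univ) :
    u ∘ inc T f ∈ vecPolySpace T k f :=
  fun j => comp_inc_mem_polySpace T f (hu j)

theorem finrank_vecPolySpace (k : ℕ) {f : Finset (Fin (n + 1))} (hf : f.Nonempty) :
    Module.finrank ℝ (vecPolySpace T k f) = (Finset.piAntidiag f k).card * n := by
  rw [← range_bernsteinField, LinearMap.finrank_range_of_inj (bernsteinField_injective T hf),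
    Module.finrank_pi_fintype]
  simp

end Bernstein

/-! ### Tangent planes, facet normals and the curl trace. -/

section Tangent

variable (T : Affine.Simplex ℝ (Euc n) n)

theorem tangentPlane_mono {e f : Finset (Fin (n + 1))} (h : e ⊆ f) :
    tangentPlane T e ≤ tangentPlane T f :=
  vectorSpan_mono ℝ (Set.image_mono (Finset.coe_subset.mpr h))

theorem sub_mem_tangentPlane {f : Finset (Fin (n + 1))} {i j : Fin (n + 1)} (hi : i ∈ f)
    (hj : j ∈ f) : T.points i - T.points j ∈ tangentPlane T f :=
  vsub_mem_vectorSpan ℝ ⟨i, hi, rfl⟩ ⟨j, hj, rfl⟩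

theorem finrank_tangentPlane {f : Finset (Fin (n + 1))} {d : ℕ} (hf : f.card = d + 1) :
    Module.finrank ℝ (tangentPlane T f) = d := by
  classical
  rw [tangentPlane, ← Finset.coe_image]
  exact T.independent.finrank_vectorSpan_image_finset hf

theorem tangentPlane_eq_zero {f : Finset (Fin (n + 1))} {s : Fin (n + 1)} (hs : s ∈ f)
    {w : Euc n} (hw : w ∈ tangentPlane T f)
    (h : ∀ i ∈ f, i ≠ s → ⟪w, T.points i - T.points s⟫ = 0) : w = 0 := by
  have hle : tangentPlane T f ≤ (ℝ ∙ w)ᗮ := by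
    rw [tangentPlane, vectorSpan_eq_span_vsub_set_right ℝ (Set.mem_image_of_mem T.points hs),
      Submodule.span_le]
    rintro _ ⟨_, ⟨i, hi, rfl⟩, rfl⟩
    rw [SetLike.mem_coe, Submodule.mem_orthogonal_singleton_iff_inner_right]
    by_cases his : i = s
    · simp [his]
    · exact h i hi his
  have := hle hw
  rwa [Submodule.mem_orthogonal_singleton_iff_inner_right, inner_self_eq_zero] at this

/-- Two vectors of `𝒯^f` normal to the facet `f \ {i}` are parallel: the pairing with an edge
through `i` detects them. -/
theorem eq_zero_of_normal {f : Finset (Fin (n + 1))} {i s : Fin (n + 1)}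
    (hs : s ∈ f) (his : s ≠ i) {w : Euc n} (hw : w ∈ tangentPlane T f)
    (h : ∀ z ∈ tangentPlane T (f.erase i), ⟪w, z⟫ = 0)
    (h' : ⟪w, T.points i - T.points s⟫ = 0) : w = 0 := by
  refine tangentPlane_eq_zero T hs hw fun j hj _ => ?_
  by_cases hji : j = i
  · rwa [hji]
  · exact h _ (sub_mem_tangentPlane T (Finset.mem_erase.2 ⟨hji, hj⟩)
      (Finset.mem_erase.2 ⟨his, hs⟩))

/-- The factor is chosen so that `w - c • ν` is also orthogonal to the edge from `s` to `i`, which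
together with the facet spans the tangent plane. -/
theorem exists_smul_eq_of_normal {f : Finset (Fin (n + 1))} {i s : Fin (n + 1)}
    (hs : s ∈ f) (his : s ≠ i) {w ν : Euc n}
    (hν : IsUnitFacetNormal T f i ν) (hw : w ∈ tangentPlane T f)
    (h : ∀ z ∈ tangentPlane T (f.erase i), ⟪w, z⟫ = 0) : ∃ c : ℝ, w = c • ν := by
  obtain ⟨hν1, hν2, hν3⟩ := hν
  set d := T.points i - T.points s
  have hd : ⟪ν, d⟫ ≠ 0 := by
    intro h0
    have := eq_zero_of_normal T hs his hν1 hν3 h0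
    rw [this, norm_zero] at hν2
    exact zero_ne_one hν2
  refine ⟨⟪w, d⟫ / ⟪ν, d⟫, ?_⟩
  rw [← sub_eq_zero]
  refine eq_zero_of_normal T hs his (sub_mem hw (Submodule.smul_mem _ _ hν1)) ?_ ?_
  · intro z hz
    rw [inner_sub_left, real_inner_smul_left, h z hz, hν3 z hz]; ring
  · rw [inner_sub_left, real_inner_smul_left]
    field_simp
    simp [d]

theorem exists_isUnitFacetNormal {f : Finset (Fin (n + 1))} {i : Fin (n + 1)} (hi : i ∈ f)
    (hf : 2 ≤ f.card) : ∃ ν, IsUnitFacetNormal T f i ν := by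
  obtain ⟨d, hd⟩ : ∃ d, f.card = d + 1 + 1 := ⟨f.card - 2, by omega⟩
  have h1 := finrank_tangentPlane T hd
  have h2 := finrank_tangentPlane T (f := f.erase i) (d := d) (by
    rw [Finset.card_erase_of_mem hi, hd]; rfl)
  have h3 := Submodule.finrank_add_inf_finrank_orthogonal
    (tangentPlane_mono T (Finset.erase_subset i f))
  have h4 : (tangentPlane T (f.erase i))ᗮ ⊓ tangentPlane T f ≠ ⊥ := by
    intro h0
    rw [h0, finrank_bot] at h3
    omega
  obtain ⟨w, ⟨hw1, hw2⟩, hw0⟩ := Submodule.exists_mem_ne_zero_of_ne_bot h4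
  refine ⟨(‖w‖⁻¹) • w, Submodule.smul_mem _ _ hw2, ?_, fun z hz => ?_⟩
  · rw [norm_smul, norm_inv, norm_norm, inv_mul_cancel₀ (norm_ne_zero_iff.2 hw0)]
  · rw [real_inner_smul_left, (Submodule.mem_orthogonal' _ _).1 hw1 z hz, mul_zero]

theorem curlTrace_smul (ν : Euc n) (c : ℝ) : curlTrace ν (c • ν) = 0 := by
  simp [curlTrace, Matrix.smul_vecMulVec, Matrix.vecMulVec_smul]

/-- Contract `v_i ν_j = ν_i v_j` with `ν_j` and use `|ν| = 1`. -/
theorem eq_smul_of_curlTrace {ν v : Euc n} (hν : ‖ν‖ = 1) (h : curlTrace ν v = 0) :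
    v = ⟪v, ν⟫ • ν := by
  ext i
  have hν' : ∑ j, ν j * ν j = 1 := by
    have := real_inner_self_eq_norm_sq ν
    rw [hν, PiLp.inner_apply] at this
    simpa [sq] using this
  have h1 : ∀ j, v i * ν j = ν i * v j := fun j => by
    have := congrFun (congrFun h i) j
    simpa [curlTrace, Matrix.vecMulVec_apply, sub_eq_zero] using this
  calc v i = ∑ j, v i * ν j * ν j := by
        simp_rw [mul_assoc]
        rw [← Finset.mul_sum, hν', mul_one]
    _ = ∑ j, (v j * ν j) * ν i := Finset.sum_congr rfl fun j _ => by rw [h1 j]; ring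
    _ = (⟪v, ν⟫ • ν) i := by
        rw [← Finset.sum_mul]
        simp [PiLp.inner_apply, mul_comm]

end Tangent

/-! ### Surface measure: finite, and positive on nonempty open sets. -/

section Measure

open MeasureTheory

variable (T : Affine.Simplex ℝ (Euc n) n)

theorem isCompact_carrier (f : Finset (Fin (n + 1))) : IsCompact (carrier T f) :=
  (f.finite_toSet.image T.points).isCompact_convexHull (𝕜 := ℝ)

instance (f : Finset (Fin (n + 1))) : CompactSpace (carrier T f) :=
  isCompact_iff_compactSpace.1 (isCompact_carrier T f)

/-- The isometric parametrization of the plane of a sub-simplex by its tangent plane. -/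
def planeChart (f : Finset (Fin (n + 1))) (s : Fin (n + 1)) (v : tangentPlane T f) : Euc n :=
  (v : Euc n) + T.points s

theorem isometry_planeChart (f : Finset (Fin (n + 1))) (s : Fin (n + 1)) :
    Isometry (planeChart T f s) :=
  (isometry_add_right (T.points s)).comp isometry_subtype_coe

theorem carrier_subset_range_planeChart {f : Finset (Fin (n + 1))} {s : Fin (n + 1)}
    (hs : s ∈ f) : carrier T f ⊆ Set.range (planeChart T f s) := by
  intro x hx
  have hx' := convexHull_subset_affineSpan _ hx
  have hs' := mem_affineSpan ℝ (Set.mem_image_of_mem T.points (Finset.mem_coe.2 hs))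
  have := AffineSubspace.vsub_mem_direction hx' hs'
  rw [direction_affineSpan] at this
  exact ⟨⟨_, this⟩, by simp [planeChart]⟩

theorem convex_preimage_planeChart (f : Finset (Fin (n + 1))) (s : Fin (n + 1)) :
    Convex ℝ (planeChart T f s ⁻¹' carrier T f) := by
  have : Convex ℝ ((fun x => x + T.points s) ⁻¹' carrier T f) :=
    (convex_convexHull ℝ _).translate_preimage_left _
  exact this.linear_preimage (tangentPlane T f).subtype

/-- A convex set has interior once its affine span is everything, and the edges at `s` span the
tangent plane. -/
theorem interior_preimage_planeChart_nonempty {f : Finset (Fin (n + 1))} {s : Fin (n + 1)}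
    (hs : s ∈ f) : (interior (planeChart T f s ⁻¹' carrier T f)).Nonempty := by
  rw [(convex_preimage_planeChart T f s).interior_nonempty_iff_affineSpan_eq_top]
  set S := planeChart T f s ⁻¹' carrier T f
  have h0 : (0 : tangentPlane T f) ∈ S := by
    simp only [S, Set.mem_preimage, planeChart, Submodule.coe_zero, zero_add]
    exact points_mem_carrier T hs
  rw [AffineSubspace.affineSpan_eq_top_iff_vectorSpan_eq_top_of_nonempty ℝ _ _ ⟨0, h0⟩,
    eq_top_iff]
  have hle : tangentPlane T f ≤ (vectorSpan ℝ S).map (tangentPlane T f).subtype := by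
    refine (vectorSpan_eq_span_vsub_set_right ℝ
      (Set.mem_image_of_mem T.points hs)).le.trans (Submodule.span_le.2 ?_)
    rintro _ ⟨_, ⟨i, hi, rfl⟩, rfl⟩
    refine ⟨⟨_, sub_mem_tangentPlane T hi hs⟩, ?_, rfl⟩
    have hi' : (⟨_, sub_mem_tangentPlane T hi hs⟩ : tangentPlane T f) ∈ S := by
      simp only [S, Set.mem_preimage, planeChart, sub_add_cancel]
      exact points_mem_carrier T hi
    simpa using vsub_mem_vectorSpan ℝ hi' h0
  intro v _
  obtain ⟨w, hw, hwv⟩ := hle v.2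
  rwa [← Subtype.ext hwv]

/-- The chart is an isometry, so it preserves Hausdorff measure, which is Lebesgue measure on a
Euclidean space of dimension `f.card - 1`. -/
theorem surfaceMeasure_apply {f : Finset (Fin (n + 1))} {s : Fin (n + 1)} (hs : s ∈ f)
    (O : Set (Euc n)) :
    surfaceMeasure T f (Subtype.val ⁻¹' O)
      = volume (planeChart T f s ⁻¹' O ∩ planeChart T f s ⁻¹' carrier T f) := by
  have hd : Module.finrank ℝ (tangentPlane T f) = f.card - 1 :=
    finrank_tangentPlane T (by have := Finset.card_pos.2 ⟨s, hs⟩; omega)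
  rw [surfaceMeasure, (MeasurableEmbedding.subtype_coe
      (isCompact_carrier T f).isClosed.measurableSet).comap_apply,
    Subtype.image_preimage_coe, ← InnerProductSpace.euclideanHausdorffMeasure_eq_volume, hd,
    ← Set.preimage_inter, (isometry_planeChart T f s).euclideanHausdorffMeasure_preimage,
    Set.inter_comm (carrier T f) O,
    Set.inter_eq_left (s := O ∩ carrier T f) (t := Set.range (planeChart T f s)) |>.2]
  exact Set.inter_subset_right.trans (carrier_subset_range_planeChart T hs)

theorem isFiniteMeasure_surfaceMeasure {f : Finset (Fin (n + 1))} (hf : f.Nonempty) :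
    IsFiniteMeasure (surfaceMeasure T f) := by
  obtain ⟨s, hs⟩ := hf
  constructor
  rw [← Set.preimage_univ (f := Subtype.val), surfaceMeasure_apply T hs, Set.preimage_univ,
    Set.univ_inter]
  exact ((isometry_planeChart T f s).isClosedEmbedding.isCompact_preimage
    (isCompact_carrier T f)).measure_lt_top

theorem isOpenPosMeasure_surfaceMeasure {f : Finset (Fin (n + 1))} (hf : f.Nonempty) :
    (surfaceMeasure T f).IsOpenPosMeasure := by
  obtain ⟨s, hs⟩ := hf
  constructor
  rintro U hU ⟨x, hx⟩
  obtain ⟨O, hO, rfl⟩ := isOpen_induced_iff.1 hU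
  rw [surfaceMeasure_apply T hs]
  have hcont := (isometry_planeChart T f s).continuous
  obtain ⟨v, hv⟩ := carrier_subset_range_planeChart T hs x.2
  -- A convex set with interior lies in the closure of that interior, so even a neighbourhood of a
  -- boundary point meets the interior.
  have hvS : v ∈ closure (interior (planeChart T f s ⁻¹' carrier T f)) := by
    rw [(convex_preimage_planeChart T f s).closure_interior_eq_closure_of_nonempty_interior
      (interior_preimage_planeChart_nonempty T hs)]
    exact subset_closure (by rw [Set.mem_preimage, hv]; exact x.2)
  have hvO : v ∈ planeChart T f s ⁻¹' O := by rw [Set.mem_preimage, hv]; exact hx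
  have hne := mem_closure_iff.1 hvS _ (hO.preimage hcont) hvO
  refine ne_of_gt (lt_of_lt_of_le
    (((hO.preimage hcont).inter isOpen_interior).measure_pos volume hne) ?_)
  exact measure_mono (Set.inter_subset_inter_right _ interior_subset)

theorem integrable_surfaceMeasure {f : Finset (Fin (n + 1))} (hf : f.Nonempty)
    {g : carrier T f → ℝ} (hg : Continuous g) : Integrable g (surfaceMeasure T f) := by
  have := isFiniteMeasure_surfaceMeasure T hf
  exact hg.integrable_of_hasCompactSupport (HasCompactSupport.of_compactSpace g)

theorem eq_zero_of_integral_inner_self {f : Finset (Fin (n + 1))} (hf : f.Nonempty)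
    {v : carrier T f → Euc n} (hv : Continuous v)
    (h : ∫ x, ⟪v x, v x⟫ ∂(surfaceMeasure T f) = 0) : v = 0 := by
  have := isOpenPosMeasure_surfaceMeasure T hf
  have hc : Continuous fun x => ⟪v x, v x⟫ := hv.inner hv
  rw [integral_eq_zero_iff_of_nonneg (fun x => real_inner_self_nonneg)
    (integrable_surfaceMeasure T hf hc)] at h
  have h' := (hc.ae_eq_iff_eq (surfaceMeasure T f) continuous_zero).1 h
  funext x
  exact inner_self_eq_zero.1 (congrFun h' x)

end Measure

/-! ### Upper bound for the total dimension of the bubble spaces. -/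

section DimensionCount

variable (T : Affine.Simplex ℝ (Euc n) n)

/-- The space of admissible Bernstein coefficients at `λ^α` of a field in the bubble space: vectors
of `𝒯^f` normal to every facet on which `λ^α` does not vanish. -/
def bubbleCoeff (f : Finset (Fin (n + 1))) (α : Fin (n + 1) → ℕ) : Submodule ℝ (Euc n) :=
  tangentPlane T f ⊓ ⨅ i ∈ f, ⨅ _ : α i = 0, (tangentPlane T (f.erase i))ᗮ

theorem mem_bubbleCoeff {f : Finset (Fin (n + 1))} {α : Fin (n + 1) → ℕ} {w : Euc n} :
    w ∈ bubbleCoeff T f α ↔ w ∈ tangentPlane T f ∧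
      ∀ i ∈ f, α i = 0 → ∀ z ∈ tangentPlane T (f.erase i), ⟪w, z⟫ = 0 := by
  simp [bubbleCoeff, Submodule.mem_iInf, Submodule.mem_orthogonal']

theorem inner_coeff_eq_zero {k : ℕ} {f : Finset (Fin (n + 1))} (hf : f.Nonempty)
    {c : Finset.piAntidiag f k → Euc n} {w : Euc n}
    (h : ∀ x, ⟪bernsteinField T k f c x, w⟫ = 0) (α) : ⟪c α, w⟫ = 0 := by
  refine congrFun (bernstein_coeff_eq_zero T hf (fun α => ⟪c α, w⟫) fun x => ?_) α
  rw [← h x, bernsteinField_apply, sum_inner]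
  exact Finset.sum_congr rfl fun α _ => by rw [real_inner_smul_left, mul_comm]

theorem coeff_mem_tangentPlane {k : ℕ} {f : Finset (Fin (n + 1))} (hf : f.Nonempty)
    {c : Finset.piAntidiag f k → Euc n}
    (h : ∀ x, bernsteinField T k f c x ∈ tangentPlane T f) (α) : c α ∈ tangentPlane T f := by
  rw [← Submodule.orthogonal_orthogonal (tangentPlane T f), Submodule.mem_orthogonal']
  intro w hw
  exact inner_coeff_eq_zero T hf (fun x => (Submodule.mem_orthogonal _ _).1 hw _ (h x)) α

/-- On `e` exactly the monomials supported in `e` survive, and these are the independent Bernstein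
monomials of `e`. -/
theorem inner_coeff_eq_zero_of_facet {k : ℕ} {f e : Finset (Fin (n + 1))} (hef : e ⊆ f)
    (he : e.Nonempty) {c : Finset.piAntidiag f k → Euc n} {w : Euc n}
    (h : ∀ x : carrier T f, (x : Euc n) ∈ carrier T e → ⟪bernsteinField T k f c x, w⟫ = 0)
    (α : Finset.piAntidiag f k) (hα : ∀ i ∉ e, α.1 i = 0) : ⟪c α, w⟫ = 0 := by
  classical
  have hsub : Finset.piAntidiag e k ⊆ Finset.piAntidiag f k := by
    intro β hβ
    obtain ⟨h1, h2⟩ := Finset.mem_piAntidiag.1 hβ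
    refine Finset.mem_piAntidiag.2 ⟨?_, fun i hi => hef (h2 i hi)⟩
    rw [← h1]
    refine (Finset.sum_subset hef fun i _ hi => ?_).symm
    by_contra h0
    exact hi (h2 i h0)
  have hαe : α.1 ∈ Finset.piAntidiag e k := by
    obtain ⟨h1, h2⟩ := Finset.mem_piAntidiag.1 α.2
    refine Finset.mem_piAntidiag.2 ⟨?_, fun i hi => ?_⟩
    · exact (Finset.sum_subset hef fun i _ hi => hα i hi).trans h1
    · by_contra h0; exact hi (hα i h0)
  refine inner_coeff_eq_zero T he (k := k) (c := fun β => c ⟨β.1, hsub β.2⟩) (fun x => ?_)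
    ⟨α.1, hαe⟩
  let y : carrier T f := ⟨x, carrier_mono T hef x.2⟩
  rw [← h y x.2]
  congr 1
  -- Extension by zero, so that the sums for `e` and `f` run over nested finite sets with the same
  -- summand.
  let C : (Fin (n + 1) → ℕ) → Euc n := fun β =>
    if hβ : β ∈ Finset.piAntidiag f k then c ⟨β, hβ⟩ else 0
  have hC : ∀ β (hβ : β ∈ Finset.piAntidiag f k), C β = c ⟨β, hβ⟩ := fun β hβ => dif_pos hβ
  have hF : bernsteinField T k f c y
      = ∑ β ∈ Finset.piAntidiag f k, bernstein T f β y • C β := by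
    refine Eq.trans ?_ (Finset.sum_coe_sort _ fun β => bernstein T f β y • C β)
    exact Finset.sum_congr rfl fun β _ => by rw [hC β.1 β.2]
  have hE : bernsteinField T k e (fun β => c ⟨β.1, hsub β.2⟩) x
      = ∑ β ∈ Finset.piAntidiag e k, bernstein T e β x • C β := by
    refine Eq.trans ?_ (Finset.sum_coe_sort _ fun β => bernstein T e β x • C β)
    exact Finset.sum_congr rfl fun β _ => by rw [hC β.1 (hsub β.2)]
  rw [hF, hE, ← Finset.sum_subset hsub]
  · refine Finset.sum_congr rfl fun β hβ => ?_
    congr 1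
    refine Finset.prod_subset hef fun i _ hi => ?_
    have : β i = 0 := by
      by_contra h0; exact hi ((Finset.mem_piAntidiag.1 hβ).2 i h0)
    rw [this, pow_zero]
  · intro β hβ hβ'
    obtain ⟨h1, h2⟩ := Finset.mem_piAntidiag.1 hβ
    obtain ⟨i, hi, hi'⟩ : ∃ i ∈ f, i ∉ e ∧ β i ≠ 0 := by
      by_contra hcon
      push Not at hcon
      refine hβ' (Finset.mem_piAntidiag.2 ⟨?_, fun i hi => ?_⟩)
      · rw [← h1]; exact Finset.sum_subset hef fun i hi hie => hcon i hi hie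
      · by_contra hie; exact hi (hcon i (h2 i hi) hie)
    have : bernstein T f β y = 0 := by
      refine Finset.prod_eq_zero hi ?_
      rw [bary_eq_zero T hi'.1 x.2, zero_pow hi'.2]
    rw [this, zero_smul]

theorem coeff_mem_bubbleCoeff {k : ℕ} {f : Finset (Fin (n + 1))} (hf : 2 ≤ f.card)
    {c : Finset.piAntidiag f k → Euc n} (h : bernsteinField T k f c ∈ curlBubble T k f) (α) :
    c α ∈ bubbleCoeff T f α.1 := by
  obtain ⟨-, h2, h3⟩ := h
  refine (mem_bubbleCoeff T).2
    ⟨coeff_mem_tangentPlane T (Finset.card_pos.1 (by omega)) h2 α, fun i hi hαi z hz => ?_⟩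
  obtain ⟨ν, hν⟩ := exists_isUnitFacetNormal T hi hf
  refine inner_coeff_eq_zero_of_facet T (Finset.erase_subset i f)
    (Finset.card_pos.1 (by rw [Finset.card_erase_of_mem hi]; omega)) (fun x hx => ?_) α
    fun j hj => ?_
  · rw [eq_smul_of_curlTrace hν.2.1 (h3 i hi ν hν x hx), real_inner_smul_left, hν.2.2 z hz,
      mul_zero]
  · by_cases hji : j = i
    · rwa [hji]
    · by_contra h0
      exact hj (Finset.mem_erase.2 ⟨hji, (Finset.mem_piAntidiag.1 α.2).2 j h0⟩)

theorem finrank_curlBubble_le (k : ℕ) {f : Finset (Fin (n + 1))} (hf : 2 ≤ f.card) :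
    Module.finrank ℝ (curlBubble T k f)
      ≤ ∑ α ∈ Finset.piAntidiag f k, Module.finrank ℝ (bubbleCoeff T f α) := by
  let Φ : ((α : Finset.piAntidiag f k) → bubbleCoeff T f α.1) →ₗ[ℝ] (carrier T f → Euc n) :=
    bernsteinField T k f ∘ₗ LinearMap.pi fun α =>
      (bubbleCoeff T f α.1).subtype ∘ₗ LinearMap.proj α
  have hle : curlBubble T k f ≤ LinearMap.range Φ := by
    intro v hv
    obtain ⟨c, rfl⟩ := exists_bernsteinField_eq T hv.1
    exact ⟨fun α => ⟨c α, coeff_mem_bubbleCoeff T hf hv α⟩, rfl⟩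
  calc _ ≤ Module.finrank ℝ (LinearMap.range Φ) := Submodule.finrank_mono hle
    _ ≤ _ := LinearMap.finrank_range_le Φ
    _ = _ := by
      rw [Module.finrank_pi_fintype]
      exact Finset.sum_coe_sort (Finset.piAntidiag f k)
        fun α => Module.finrank ℝ (bubbleCoeff T f α)

/-- Each vertex of `f` outside `S` imposes normality to the opposite facet. One such condition
leaves a line; a second leaves nothing, since the edge from `s ∈ S` to the first vertex lies in the
second facet. -/
theorem finrank_bubbleCoeff_le {f : Finset (Fin (n + 1))} {α : Fin (n + 1) → ℕ}
    {S : Finset (Fin (n + 1))} (hS : ∀ i, i ∈ S ↔ α i ≠ 0) (hS0 : S.Nonempty) (hSf : S ⊆ f) :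
    Module.finrank ℝ (bubbleCoeff T f α)
      ≤ (if f = S then S.card - 1 else 0) + ∑ i ∈ Sᶜ, if f = insert i S then 1 else 0 := by
  obtain ⟨s, hs⟩ := hS0
  by_cases h1 : f = S
  · rw [if_pos h1, h1]
    refine le_add_right ?_
    refine (Submodule.finrank_mono inf_le_left).trans (le_of_eq (finrank_tangentPlane T ?_))
    have := Finset.card_pos.2 ⟨s, hs⟩
    omega
  · rw [if_neg h1, zero_add]
    obtain ⟨i, hif, hiS⟩ := Finset.exists_of_ssubset (Finset.ssubset_iff_subset_ne.2 ⟨hSf, Ne.symm h1⟩)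
    have hsi : s ≠ i := fun h => hiS (h ▸ hs)
    have hαi : α i = 0 := by_contra fun h => hiS ((hS i).2 h)
    by_cases h2 : f = insert i S
    · have hle : 1 ≤ ∑ j ∈ Sᶜ, if f = insert j S then 1 else 0 := by
        rw [Nat.one_le_iff_ne_zero]
        intro h0
        have := Finset.sum_eq_zero_iff.1 h0 i (Finset.mem_compl.2 hiS)
        rw [if_pos h2] at this
        exact one_ne_zero this
      refine le_trans ?_ hle
      let A : bubbleCoeff T f α →ₗ[ℝ] ℝ :=
        (innerₛₗ ℝ (T.points i - T.points s)) ∘ₗ (bubbleCoeff T f α).subtype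
      have hA : Function.Injective A := by
        rw [← LinearMap.ker_eq_bot, LinearMap.ker_eq_bot']
        rintro ⟨w, hw⟩ hw0
        have hw' := (mem_bubbleCoeff T).1 hw
        refine Subtype.ext (eq_zero_of_normal T (hSf hs) hsi hw'.1 (hw'.2 i hif hαi) ?_)
        rw [real_inner_comm]
        exact hw0
      simpa using LinearMap.finrank_le_finrank_of_injective hA
    · obtain ⟨j, hjf, hjS⟩ := Finset.exists_of_ssubset (Finset.ssubset_iff_subset_ne.2
        ⟨Finset.insert_subset hif hSf, Ne.symm h2⟩)
      rw [Finset.mem_insert, not_or] at hjS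
      have hαj : α j = 0 := by_contra fun h => hjS.2 ((hS j).2 h)
      have hsj : s ≠ j := fun h => hjS.2 (h ▸ hs)
      have hbot : bubbleCoeff T f α = ⊥ := by
        rw [Submodule.eq_bot_iff]
        intro w hw
        have hw' := (mem_bubbleCoeff T).1 hw
        refine eq_zero_of_normal T (hSf hs) hsi hw'.1 (hw'.2 i hif hαi) (hw'.2 j hjf hαj _ ?_)
        exact sub_mem_tangentPlane T (Finset.mem_erase.2 ⟨Ne.symm hjS.1, hif⟩)
          (Finset.mem_erase.2 ⟨hsj, hSf hs⟩)
      rw [hbot, finrank_bot]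
      exact Nat.zero_le _

theorem sum_finrank_curlBubble_le {k : ℕ} (hk : 1 ≤ k) :
    ∑ f : {f : Finset (Fin (n + 1)) // 2 ≤ f.card}, Module.finrank ℝ (curlBubble T k f.1)
      ≤ (Finset.piAntidiag (Finset.univ : Finset (Fin (n + 1))) k).card * n := by
  classical
  let supp : (Fin (n + 1) → ℕ) → Finset (Fin (n + 1)) := fun α => {i | α i ≠ 0}
  let m : Finset (Fin (n + 1)) → (Fin (n + 1) → ℕ) → ℕ := fun f α =>
    (if f = supp α then (supp α).card - 1 else 0)
      + ∑ i ∈ (supp α)ᶜ, if f = insert i (supp α) then 1 else 0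
  have hsupp : ∀ α i, i ∈ supp α ↔ α i ≠ 0 := by simp [supp]
  have hm : ∀ α ∈ Finset.piAntidiag (Finset.univ : Finset (Fin (n + 1))) k, ∑ f, m f α = n := by
    intro α hα
    -- Here `k ≥ 1` enters: an empty support would spoil the truncated `|S| - 1` and the final sum.
    have hpos : 0 < (supp α).card := by
      rw [Finset.card_pos]
      by_contra h0
      have h1 := (Finset.mem_piAntidiag.1 hα).1
      rw [Finset.sum_eq_zero] at h1
      · omega
      · intro i _
        by_contra hi
        exact h0 ⟨i, (hsupp α i).2 hi⟩
    simp only [m, Finset.sum_add_distrib]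
    rw [Finset.sum_comm]
    simp only [Finset.sum_ite_eq', Finset.mem_univ, if_true, Finset.sum_const, smul_eq_mul,
      Finset.card_compl, Fintype.card_fin, mul_one]
    have : (supp α).card ≤ n + 1 := by simpa using Finset.card_le_univ (supp α)
    omega
  calc _ ≤ ∑ f : {f : Finset (Fin (n + 1)) // 2 ≤ f.card},
        ∑ α ∈ Finset.piAntidiag Finset.univ k, m f.1 α := by
        refine Finset.sum_le_sum fun f _ => (finrank_curlBubble_le T k f.2).trans ?_
        have hsub : Finset.piAntidiag f.1 k ⊆ Finset.piAntidiag Finset.univ k := by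
          intro α hα
          obtain ⟨h1, h2⟩ := Finset.mem_piAntidiag.1 hα
          refine Finset.mem_piAntidiag.2 ⟨?_, fun i _ => Finset.mem_univ i⟩
          rw [← h1]
          refine (Finset.sum_subset (Finset.subset_univ _) fun i _ hi => ?_).symm
          by_contra h0
          exact hi (h2 i h0)
        refine le_trans (Finset.sum_le_sum fun α hα => ?_) (Finset.sum_le_sum_of_subset hsub)
        obtain ⟨h1, h2⟩ := Finset.mem_piAntidiag.1 hα
        refine finrank_bubbleCoeff_le T (hsupp α) ?_ fun i hi => h2 i ((hsupp α i).1 hi)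
        by_contra h0
        rw [Finset.sum_eq_zero] at h1
        · omega
        · intro i _
          by_contra hi
          exact h0 ⟨i, (hsupp α i).2 hi⟩
    _ ≤ ∑ f, ∑ α ∈ Finset.piAntidiag Finset.univ k, m f α := by
        refine le_trans (le_of_eq ?_) (Finset.sum_le_sum_of_subset
          (Finset.filter_subset (fun f => 2 ≤ f.card) Finset.univ))
        exact (Finset.sum_subtype _ (by simp)
          fun f => ∑ α ∈ Finset.piAntidiag Finset.univ k, m f α).symm
    _ = ∑ α ∈ Finset.piAntidiag Finset.univ k, n := by
        rw [Finset.sum_comm]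
        exact Finset.sum_congr rfl hm
    _ = _ := by simp

end DimensionCount

/-! ### Bijectivity of the moment map. -/

section Unisolvence

open MeasureTheory

variable (T : Affine.Simplex ℝ (Euc n) n)

theorem continuous_inc (f : Finset (Fin (n + 1))) : Continuous (inc T f) :=
  continuous_inclusion (carrier_mono T (Finset.subset_univ f))

instance (k : ℕ) (f : Finset (Fin (n + 1))) : FiniteDimensional ℝ (curlBubble T k f) :=
  Submodule.finiteDimensional_of_le (S₂ := vecPolySpace T k f) fun _ hv => hv.1

theorem continuous_of_mem_curlBubble {k : ℕ} {f : Finset (Fin (n + 1))}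
    {v : carrier T f → Euc n} (hv : v ∈ curlBubble T k f) : Continuous v :=
  continuous_of_mem_vecPolySpace T hv.1

theorem integrable_inner {k : ℕ} {f : Finset (Fin (n + 1))} (hf : f.Nonempty)
    (u : vecPolySpace T k Finset.univ) (p : curlBubble T k f) :
    Integrable (fun x => ⟪u.1 (inc T f x), p.1 x⟫) (surfaceMeasure T f) :=
  integrable_surfaceMeasure T hf
    (((continuous_of_mem_vecPolySpace T u.2).comp (continuous_inc T f)).inner
      (continuous_of_mem_curlBubble T p.2))

/-- The moments of a field against the bubble spaces of all sub-simplices of positive dimension. -/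
def moments (k : ℕ) : vecPolySpace T k Finset.univ →ₗ[ℝ]
    ((f : {f : Finset (Fin (n + 1)) // 2 ≤ f.card}) → Module.Dual ℝ (curlBubble T k f.1)) :=
  LinearMap.pi fun f => LinearMap.mk₂ ℝ
    (fun u p => ∫ x, ⟪u.1 (inc T f.1 x), p.1 x⟫ ∂(surfaceMeasure T f.1))
    (fun u v p => by
      have hf : f.1.Nonempty := Finset.card_pos.1 (by have := f.2; omega)
      rw [← integral_add (integrable_inner T hf u p) (integrable_inner T hf v p)]
      simp [inner_add_left])
    (fun c u p => by
      rw [smul_eq_mul, ← integral_const_mul]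
      simp [real_inner_smul_left])
    (fun u p q => by
      have hf : f.1.Nonempty := Finset.card_pos.1 (by have := f.2; omega)
      rw [← integral_add (integrable_inner T hf u p) (integrable_inner T hf u q)]
      simp [inner_add_right])
    (fun c u p => by
      rw [smul_eq_mul, ← integral_const_mul]
      simp [real_inner_smul_right])

theorem moments_apply {k : ℕ} (u : vecPolySpace T k Finset.univ)
    (f : {f : Finset (Fin (n + 1)) // 2 ≤ f.card}) (p : curlBubble T k f.1) :
    moments T k u f p = ∫ x, ⟪u.1 (inc T f.1 x), p.1 x⟫ ∂(surfaceMeasure T f.1) := rfl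

/-- If the moments of `u` vanish, so do its tangential components on every sub-simplex. -/
theorem inner_eq_zero_of_moments {k : ℕ} {u : vecPolySpace T k Finset.univ}
    (hu : moments T k u = 0) (f : Finset (Fin (n + 1))) (x : carrier T f) :
    ∀ w ∈ tangentPlane T f, ⟪u.1 (inc T f x), w⟫ = 0 := by
  classical
  induction f using Finset.strongInduction with
  | H f ih =>
    by_cases hf : 2 ≤ f.card
    · have hne : f.Nonempty := Finset.card_pos.1 (by omega)
      let P : Euc n →ₗ[ℝ] Euc n := (tangentPlane T f).starProjection.toLinearMap
      have hPmem : ∀ z, P z ∈ tangentPlane T f := fun z =>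
        Submodule.starProjection_apply_mem _ z
      have hP : ∀ z, ∀ w ∈ tangentPlane T f, ⟪P z, w⟫ = ⟪z, w⟫ := fun z w hw => by
        have := Submodule.starProjection_inner_eq_zero z w hw
        rw [inner_sub_left, sub_eq_zero] at this
        exact this.symm
      let v : carrier T f → Euc n := fun x => P (u.1 (inc T f x))
      have hvP : v ∈ vecPolySpace T k f :=
        comp_linear_mem_vecPolySpace T (comp_inc_mem_vecPolySpace T f u.2) P
      have hv : v ∈ curlBubble T k f := by
        refine ⟨hvP, fun x => hPmem _, fun i hi ν hν x hx => ?_⟩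
        -- By induction `u` is orthogonal to the facet plane on the facet, so its projection is a
        -- multiple of `ν` there and has zero curl trace.
        obtain ⟨s, hs⟩ : (f.erase i).Nonempty :=
          Finset.card_pos.1 (by rw [Finset.card_erase_of_mem hi]; omega)
        obtain ⟨c, hc⟩ := exists_smul_eq_of_normal T (Finset.mem_of_mem_erase hs)
          (Finset.ne_of_mem_erase hs) hν (hPmem (u.1 (inc T f x))) fun z hz => by
            rw [hP _ z (tangentPlane_mono T (Finset.erase_subset i f) hz)]
            exact ih _ (Finset.erase_ssubset hi) ⟨x, hx⟩ z hz
        simp only [v, hc, curlTrace_smul]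
      have h0 : v = 0 := by
        refine eq_zero_of_integral_inner_self T hne (continuous_of_mem_vecPolySpace T hvP) ?_
        have := LinearMap.congr_fun (congrFun hu ⟨f, hf⟩) ⟨v, hv⟩
        rw [moments_apply] at this
        refine Eq.trans (integral_congr_ae (Filter.Eventually.of_forall fun x => ?_)) this
        exact hP _ _ (hPmem _)
      intro w hw
      rw [← hP _ w hw, show P (u.1 (inc T f x)) = 0 from congrFun h0 x, inner_zero_left]
    -- Base case: a vertex or the empty face has zero tangent plane.
    · intro w hw
      have hsub : (T.points '' (f : Set (Fin (n + 1)))).Subsingleton := by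
        have : (f : Set (Fin (n + 1))).Subsingleton :=
          Finset.card_le_one_iff_subsingleton.1 (by omega)
        exact this.image _
      rw [tangentPlane, vectorSpan_of_subsingleton ℝ hsub, Submodule.mem_bot] at hw
      rw [hw, inner_zero_right]

theorem moments_injective (k : ℕ) : Function.Injective (moments T k) := by
  rw [← LinearMap.ker_eq_bot, LinearMap.ker_eq_bot']
  intro u hu
  refine Subtype.ext (funext fun x => ?_)
  have htop : tangentPlane T Finset.univ = ⊤ :=
    Submodule.eq_top_of_finrank_eq (by rw [finrank_tangentPlane T (d := n) (by simp)]; simp)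
  have := inner_eq_zero_of_moments T hu Finset.univ x (u.1 x) (by rw [htop]; trivial)
  exact inner_self_eq_zero.1 this

theorem moments_bijective {k : ℕ} (hk : 1 ≤ k) : Function.Bijective (moments T k) := by
  have hinj := moments_injective T k
  refine ⟨hinj, (LinearMap.injective_iff_surjective_of_finrank_eq_finrank ?_).1 hinj⟩
  refine le_antisymm (LinearMap.finrank_le_finrank_of_injective hinj) ?_
  rw [finrank_vecPolySpace T k Finset.univ_nonempty, Module.finrank_pi_fintype]
  simp only [Subspace.dual_finrank_eq]
  exact sum_finrank_curlBubble_le T hk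

end Unisolvence

/-! ### Edge moments as bubble moments. -/

section Edge

variable (T : Affine.Simplex ℝ (Euc n) n)

/-- The tangential component, with respect to `t`, of a bubble field. -/
def tangentialComponent (k : ℕ) (e : Finset (Fin (n + 1))) (t : Euc n) :
    curlBubble T k e →ₗ[ℝ] polySpace T k e where
  -- The scaling makes this the coefficient of `t`, inverse to `p ↦ p t` for `t` of any nonzero
  -- length.
  toFun p := ⟨fun x => ⟪p.1 x, (‖t‖ ^ 2)⁻¹ • t⟫, inner_mem_polySpace T p.2.1 _⟩
  map_add' p q := by ext x; simp [inner_add_left]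
  map_smul' c p := by ext x; simp [real_inner_smul_left]

theorem tangentialComponent_apply {k : ℕ} {e : Finset (Fin (n + 1))} (t : Euc n)
    (p : curlBubble T k e) (x : carrier T e) :
    (tangentialComponent T k e t p).1 x = ⟪p.1 x, (‖t‖ ^ 2)⁻¹ • t⟫ := rfl

theorem tangentialComponent_smul {k : ℕ} {e : Finset (Fin (n + 1))} {t : Euc n}
    (ht : Submodule.span ℝ {t} = tangentPlane T e) (p : curlBubble T k e) (x : carrier T e) :
    (tangentialComponent T k e t p).1 x • t = p.1 x := by
  have h := p.2.2.1 x
  rw [← ht] at h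
  obtain ⟨c, hc⟩ := Submodule.mem_span_singleton.1 h
  rw [tangentialComponent_apply, ← hc]
  by_cases h0 : t = 0
  · simp [h0]
  · have : ‖t‖ ≠ 0 := norm_ne_zero_iff.2 h0
    rw [real_inner_smul_left, real_inner_smul_right, real_inner_self_eq_norm_sq,
      inv_mul_cancel₀ (pow_ne_zero 2 this), mul_one]

/-- On an edge, all polynomial tangential fields are bubble fields. -/
theorem smul_tangent_mem_curlBubble {k : ℕ} {e : Finset (Fin (n + 1))} (he : e.card = 2)
    {t : Euc n} (ht : Submodule.span ℝ {t} = tangentPlane T e) (p : polySpace T k e) :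
    (fun x => p.1 x • t) ∈ curlBubble T k e := by
  have htm : t ∈ tangentPlane T e := ht ▸ Submodule.mem_span_singleton_self t
  refine ⟨smul_const_mem_vecPolySpace T p.2 t, fun x => Submodule.smul_mem _ _ htm,
    fun i hi ν hν x _ => ?_⟩
  obtain ⟨s, hs⟩ : (e.erase i).Nonempty :=
    Finset.card_pos.1 (by rw [Finset.card_erase_of_mem hi]; omega)
  -- The facets of an edge are points, so every tangent vector is normal to them and the trace
  -- condition is void.
  have hbot : tangentPlane T (e.erase i) = ⊥ := by
    rw [← Submodule.finrank_eq_zero (R := ℝ)]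
    exact finrank_tangentPlane T (by rw [Finset.card_erase_of_mem hi, he])
  obtain ⟨c, hc⟩ := exists_smul_eq_of_normal T (Finset.mem_of_mem_erase hs)
    (Finset.ne_of_mem_erase hs) hν (w := p.1 x • t) (Submodule.smul_mem _ _ htm) fun z hz => by
      rw [hbot, Submodule.mem_bot] at hz
      rw [hz, inner_zero_right]
  simp only [hc, curlTrace_smul]

theorem tangentialComponent_smul_tangent {k : ℕ} {e : Finset (Fin (n + 1))} (he : e.card = 2)
    {t : Euc n} (ht : Submodule.span ℝ {t} = tangentPlane T e) (p : polySpace T k e) :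
    tangentialComponent T k e t ⟨_, smul_tangent_mem_curlBubble T he ht p⟩ = p := by
  have h0 : ‖t‖ ≠ 0 := by
    rw [norm_ne_zero_iff]
    rintro rfl
    have h1 := finrank_tangentPlane T (d := 1) he
    rw [← ht, Submodule.span_zero_singleton, finrank_bot] at h1
    exact zero_ne_one h1
  ext x
  rw [tangentialComponent_apply, real_inner_smul_left, real_inner_smul_right,
    real_inner_self_eq_norm_sq, inv_mul_cancel₀ (pow_ne_zero 2 h0), mul_one]

theorem edge_moments_iff {k : ℕ} {e : Finset (Fin (n + 1))} (he : e.card = 2) {t : Euc n}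
    (ht : Submodule.span ℝ {t} = tangentPlane T e) (a : Module.Dual ℝ (polySpace T k e))
    (u : vecPolySpace T k Finset.univ) :
    (∀ p : polySpace T k e,
      ∫ x, ⟪u.1 (inc T e x), t⟫ * p.1 x ∂(surfaceMeasure T e) = a p) ↔
    ∀ p : curlBubble T k e, ∫ x, ⟪u.1 (inc T e x), p.1 x⟫ ∂(surfaceMeasure T e)
      = a (tangentialComponent T k e t p) := by
  constructor
  · intro h p
    rw [← h]
    refine congrArg _ (funext fun x => ?_)
    rw [← tangentialComponent_smul T ht p x, real_inner_smul_right, mul_comm]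
  · intro h p
    have := h ⟨_, smul_tangent_mem_curlBubble T he ht p⟩
    rw [tangentialComponent_smul_tangent T he ht] at this
    rw [← this]
    refine congrArg _ (funext fun x => ?_)
    rw [real_inner_smul_right, mul_comm]

theorem mem_subsimplices_iff {l : ℕ} {f : Finset (Fin (n + 1))} :
    f ∈ subsimplices n l ↔ f.card = l + 1 := by
  simp [subsimplices, Finset.mem_powersetCard]

end Edge

end EdgeElement

end
-- Unisolvence of the two families together.
theorem theorem5p6 (n k : ℕ) (hn : 1 ≤ n) (hk : 1 ≤ k)
    (T : Affine.Simplex ℝ (EuclideanSpace ℝ (Fin n)) n)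
    (t : Finset (Fin (n + 1)) → EuclideanSpace ℝ (Fin n))
    (ht : ∀ e ∈ EdgeElement.subsimplices n 1,
      Submodule.span ℝ {t e} = EdgeElement.tangentPlane T e)
    (a : ∀ e : Finset (Fin (n + 1)), Module.Dual ℝ (EdgeElement.polySpace T k e))
    (b : ∀ f : Finset (Fin (n + 1)), Module.Dual ℝ (EdgeElement.curlBubble T k f)) :
    ∃! u : EdgeElement.vecPolySpace T k Finset.univ,
      (∀ e ∈ EdgeElement.subsimplices n 1, ∀ p : EdgeElement.polySpace T k e,
        ∫ x, ⟪u.1 (EdgeElement.inc T e x), t e⟫ * p.1 x ∂(EdgeElement.surfaceMeasure T e)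
          = a e p) ∧
      (∀ l : ℕ, 2 ≤ l → l ≤ n → ∀ f ∈ EdgeElement.subsimplices n l,
        ∀ p : EdgeElement.curlBubble T k f,
          ∫ x, ⟪u.1 (EdgeElement.inc T f x), p.1 x⟫ ∂(EdgeElement.surfaceMeasure T f)
            = b f p) := by
  -- One functional per bubble space: on edges `a` is transported along the tangential component, on
  -- larger faces `b` is kept.
  let d : (f : {f : Finset (Fin (n + 1)) // 2 ≤ f.card}) →
      Module.Dual ℝ (EdgeElement.curlBubble T k f.1) := fun f =>
    if f.1.card = 2 then a f.1 ∘ₗ EdgeElement.tangentialComponent T k f.1 (t f.1) else b f.1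
  refine (existsUnique_congr fun u => ?_).2
    ((EdgeElement.moments_bijective T hk).existsUnique d)
  constructor
  · rintro ⟨h1, h2⟩
    funext f
    refine LinearMap.ext fun p => ?_
    rw [EdgeElement.moments_apply]
    by_cases hf : f.1.card = 2
    · have he : f.1 ∈ EdgeElement.subsimplices n 1 := EdgeElement.mem_subsimplices_iff.2 hf
      rw [(EdgeElement.edge_moments_iff T hf (ht _ he) (a f.1) u).1 (h1 _ he) p]
      simp [d, hf]
    · have hfn : f.1.card ≤ n + 1 := by simpa using Finset.card_le_univ f.1
      have := f.2
      rw [h2 (f.1.card - 1) (by omega) (by omega) f.1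
        (EdgeElement.mem_subsimplices_iff.2 (by omega)) p]
      simp [d, hf]
  · intro h
    refine ⟨fun e he => ?_, fun l hl _ f hf p => ?_⟩
    · have hc := EdgeElement.mem_subsimplices_iff.1 he
      refine (EdgeElement.edge_moments_iff T hc (ht e he) (a e) u).2 fun p => ?_
      have := LinearMap.congr_fun (congrFun h ⟨e, hc.ge⟩) p
      rw [EdgeElement.moments_apply] at this
      simpa [d, hc] using this
    · have hc := EdgeElement.mem_subsimplices_iff.1 hf
      have := LinearMap.congr_fun (congrFun h ⟨f, by omega⟩) p
      rw [EdgeElement.moments_apply] at this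
      have hc2 : f.card ≠ 2 := by omega
      simpa [d, hc2] using this
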